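/- Let $n\ge 2$, let $x=(x_1,\dots,x_{n+1})$ be the standard coordinate system on $\mathbb{R}^{n+1}$, and let $y=(y_1,\dots,y_{n+1})$ be another (global) $C^2$ coordinate system on $\mathbb{R}^{n+1}$, that is, a $C^2$ diffeomorphism $x\mapsto y(x)$ (with $C^2$ inverse) from $\mathbb{R}^{n+1}$ onto an open subset of $\mathbb{R}^{n+1}$. Suppose that for every $C^2$ function $\varphi:\mathbb{R}^{n+1}\to\mathbb{R}$, $$\sum_{i=1}^{n}\frac{\partial^2\varphi}{\partial x_i^2}-\frac{\partial^2\varphi}{\partial x_{n+1}^2}=0 \text{ on } \mathbb{R}^{n+1}\quad\Longleftrightarrow\quad \sum_{i=1}^{n}\frac{\partial^2\varphi}{\partial y_i^2}-\frac{\partial^2\varphi}{\partial y_{n+1}^2}=0 \text{ on } \mathbb{R}^{n+1},$$ where $\partial\varphi/\partial y_i$ denotes the partial derivative of $\varphi$ expressed as a function of $y$. Then the coordinate transformation $x\mapsto y$ and its inverse are $C^\infty$; moreover, $x\mapsto y$ is an invertible affine map of $\mathbb{R}^{n+1}$ onto itself. -/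

import Mathlib

open scoped ContDiff

/-- `ℝ^{n+1}`; the last coordinate is the time coordinate. -/
abbrev Spacetime (n : ℕ) : Type := EuclideanSpace ℝ (Fin (n + 1))

/-- `Y = (y_1, …, y_{n+1})` is a (global) `C^k` coordinate system on `ℝ^{n+1}`: a `C^k`
diffeomorphism from the whole of `ℝ^{n+1}` onto an open subset of `ℝ^{n+1}`. -/
structure IsCoordinateSystem {n : ℕ} (k : WithTop ℕ∞)
    (Y : OpenPartialHomeomorph (Spacetime n) (Spacetime n)) : Prop where
  source_eq : Y.source = Set.univ
  contDiffOn : ContDiffOn ℝ k Y Y.source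
  contDiffOn_symm : ContDiffOn ℝ k Y.symm Y.target

/-- The standard coordinate system `(x_1, …, x_{n+1})`. -/
def standardCoordinates (n : ℕ) : OpenPartialHomeomorph (Spacetime n) (Spacetime n) :=
  OpenPartialHomeomorph.refl (Spacetime n)

/-- The function `∂φ/∂y_i`: express `φ` in the coordinates `Y`, and take the derivative in the
direction of the `i`-th coordinate. -/
noncomputable def coordPartial {n : ℕ} (Y : OpenPartialHomeomorph (Spacetime n) (Spacetime n))
    (i : Fin (n + 1)) (φ : Spacetime n → ℝ) : Spacetime n → ℝ :=
  fun p => lineDeriv ℝ (φ ∘ Y.symm) (Y p) (EuclideanSpace.single i 1)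

/-- `φ` satisfies, on all of `ℝ^{n+1}`, the wave equation
`∑_{i ≤ n} ∂²φ/∂y_i² - ∂²φ/∂y_{n+1}² = 0` with respect to the coordinates `Y`. -/
def SatisfiesWaveEquation {n : ℕ} (Y : OpenPartialHomeomorph (Spacetime n) (Spacetime n))
    (φ : Spacetime n → ℝ) : Prop :=
  ∀ p : Spacetime n,
    (∑ i : Fin n, coordPartial Y i.castSucc (coordPartial Y i.castSucc φ) p)
      - coordPartial Y (Fin.last n) (coordPartial Y (Fin.last n) φ) p = 0

/-!
A coordinate system whose wave solutions are solutions in the standard coordinates is a harmonic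
morphism `F` of Minkowski space: it pulls solutions back to solutions. Applied to linear functions,
this says that the components of `F` are solutions. Applied to the quadratic functions `B(q, q)`
with `B` trace-free, it says that `F` is conformal: the differential of `F` multiplies the metric
`g` by a function `c`. Differentiating `g (DF v, DF w) = c g (v, w)` and permuting the directions
as in the Koszul formula gives
`2 g (D²F (u, v), DF w) = dc(u) g (v, w) + dc(v) g (u, w) - dc(w) g (u, v)`.
The trace over `u, v` reads `0 = (2 - dim) dc(w)`. So `dc = 0` outside dimension two, whence
`D²F = 0` and `F` is affine.
-/

section SecondDerivative

variable {𝕜 E V W : Type*} [NontriviallyNormedField 𝕜] [NormedAddCommGroup E] [NormedSpace 𝕜 E]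
  [NormedAddCommGroup V] [NormedSpace 𝕜 V] [NormedAddCommGroup W] [NormedSpace 𝕜 W]

theorem differentiable_fderiv_of_contDiff_two {f : E → V} (hf : ContDiff 𝕜 2 f) :
    Differentiable 𝕜 (fderiv 𝕜 f) :=
  (hf.fderiv_right (m := 1) (by norm_num)).differentiable one_ne_zero

theorem lineDeriv_lineDeriv_eq_fderiv_fderiv {f : E → V} (hf : ContDiff 𝕜 2 f) (p u v : E) :
    lineDeriv 𝕜 (fun q => lineDeriv 𝕜 f q v) p u = fderiv 𝕜 (fderiv 𝕜 f) p u v := by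
  have hf₁ : Differentiable 𝕜 f := hf.differentiable two_ne_zero
  have hf₂ := differentiable_fderiv_of_contDiff_two hf
  have hline : (fun q => lineDeriv 𝕜 f q v) = fun q => fderiv 𝕜 f q v :=
    funext fun q => (hf₁ q).lineDeriv_eq_fderiv
  rw [hline, DifferentiableAt.lineDeriv_eq_fderiv (by fun_prop),
    fderiv_clm_apply (hf₂ p) (differentiableAt_const v)]
  simp

theorem fderiv_fderiv_comp {ψ : V → W} {F : E → V} (hψ : ContDiff 𝕜 2 ψ) (hF : ContDiff 𝕜 2 F)
    (p u v : E) :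
    fderiv 𝕜 (fderiv 𝕜 (ψ ∘ F)) p u v =
      fderiv 𝕜 (fderiv 𝕜 ψ) (F p) (fderiv 𝕜 F p u) (fderiv 𝕜 F p v) +
        fderiv 𝕜 ψ (F p) (fderiv 𝕜 (fderiv 𝕜 F) p u v) := by
  have hψ₁ : Differentiable 𝕜 ψ := hψ.differentiable two_ne_zero
  have hF₁ : Differentiable 𝕜 F := hF.differentiable two_ne_zero
  have hψ₂ := differentiable_fderiv_of_contDiff_two hψ
  have hF₂ := differentiable_fderiv_of_contDiff_two hF
  have hchain : fderiv 𝕜 (ψ ∘ F) = fun q => (fderiv 𝕜 ψ (F q)).comp (fderiv 𝕜 F q) :=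
    funext fun q => fderiv_comp q (hψ₁ _) (hF₁ q)
  have hψF : HasFDerivAt (fun q => fderiv 𝕜 ψ (F q))
      ((fderiv 𝕜 (fderiv 𝕜 ψ) (F p)).comp (fderiv 𝕜 F p)) p :=
    (hψ₂ _).hasFDerivAt.comp p (hF₁ p).hasFDerivAt
  rw [hchain, (hψF.clm_comp (hF₂ p).hasFDerivAt).fderiv]
  simp [add_comm]

theorem fderiv_fderiv_continuousLinearMap (L : E →L[𝕜] V) (p : E) :
    fderiv 𝕜 (fderiv 𝕜 L) p = 0 := by
  have hconst : fderiv 𝕜 L = fun _ => L := funext fun _ => L.fderiv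
  rw [hconst, fderiv_fun_const, Pi.zero_apply]

theorem fderiv_fderiv_bilin_diag (B : E →L[𝕜] E →L[𝕜] V) (p u v : E) :
    fderiv 𝕜 (fderiv 𝕜 fun q => B q q) p u v = B u v + B v u := by
  have hgrad : fderiv 𝕜 (fun q => B q q) = ⇑(B + B.flip) := by
    ext q v
    rw [B.fderiv_of_bilinear differentiableAt_fun_id differentiableAt_fun_id]
    simp
  rw [hgrad, ContinuousLinearMap.fderiv]
  simp

theorem fderiv_injective_of_leftInverse {F : E → V} {G : V → E} {p : E}
    (hF : DifferentiableAt 𝕜 F p) (hG : DifferentiableAt 𝕜 G (F p))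
    (h : Function.LeftInverse G F) : Function.Injective (fderiv 𝕜 F p) := by
  have hcomp : HasFDerivAt id ((fderiv 𝕜 G (F p)).comp (fderiv 𝕜 F p)) p := by
    simpa only [h.comp_eq_id] using hG.hasFDerivAt.comp p hF.hasFDerivAt
  have hid := hcomp.unique (hasFDerivAt_id p)
  exact Function.LeftInverse.injective (g := fderiv 𝕜 G (F p)) (DFunLike.congr_fun hid)

end SecondDerivative

section Affine

variable {E V : Type*} [NormedAddCommGroup E] [NormedSpace ℝ E]
  [NormedAddCommGroup V] [NormedSpace ℝ V]

theorem eq_fderiv_add_of_fderiv_fderiv_eq_zero {F : E → V} (hF : ContDiff ℝ 2 F)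
    (h : ∀ p, fderiv ℝ (fderiv ℝ F) p = 0) (p : E) : F p = fderiv ℝ F 0 p + F 0 := by
  have hF₁ : Differentiable ℝ F := hF.differentiable two_ne_zero
  have hconst (q : E) : fderiv ℝ F q = fderiv ℝ F 0 :=
    is_const_of_fderiv_eq_zero (differentiable_fderiv_of_contDiff_two hF) h q 0
  have hsub : F p - fderiv ℝ F 0 p = F 0 - fderiv ℝ F 0 0 :=
    is_const_of_fderiv_eq_zero (f := fun q => F q - fderiv ℝ F 0 q) (by fun_prop)
      (fun q => by
        rw [fderiv_fun_sub (hF₁ q) (fderiv ℝ F 0).differentiableAt, hconst q,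
          ContinuousLinearMap.fderiv, sub_self]) p 0
  rwa [map_zero, sub_zero, sub_eq_iff_eq_add'] at hsub

theorem exists_affineEquiv_of_fderiv_fderiv_eq_zero [FiniteDimensional ℝ E] {F : E → E}
    (hF : ContDiff ℝ 2 F) (hinj : Function.Injective (fderiv ℝ F 0))
    (h : ∀ p, fderiv ℝ (fderiv ℝ F) p = 0) : ∃ A : E ≃ᵃ[ℝ] E, ∀ p, F p = A p := by
  let L : E ≃ₗ[ℝ] E := LinearEquiv.ofInjectiveEndo (fderiv ℝ F 0).toLinearMap hinj
  refine ⟨L.toAffineEquiv.trans (AffineEquiv.constVAdd ℝ E (F 0)), fun p => ?_⟩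
  rw [eq_fderiv_add_of_fderiv_fderiv_eq_zero hF h p, add_comm]
  rfl

end Affine

theorem koszul_formula {α : Type*} {T g : α → α → α → ℝ} (hT : ∀ u v w, T u v w = T v u w)
    (h : ∀ u v w, T u v w + T u w v = g u v w) (u v w : α) :
    2 * T u v w = g u v w + g v u w - g w u v := by
  linear_combination h u v w + h v u w - h w u v + hT u v w + hT w u v + hT w v u

theorem bilin_fderiv_fderiv_add_of_conformal {E V : Type*} [NormedAddCommGroup E]
    [NormedSpace ℝ E] [NormedAddCommGroup V] [NormedSpace ℝ V] {g : E →L[ℝ] E →L[ℝ] ℝ}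
    {h : V →L[ℝ] V →L[ℝ] ℝ} {F : E → V} {c : E → ℝ} (hF : ContDiff ℝ 2 F)
    (hc : Differentiable ℝ c)
    (hconf : ∀ p u v, h (fderiv ℝ F p u) (fderiv ℝ F p v) = c p * g u v) (p k u v : E) :
    h (fderiv ℝ (fderiv ℝ F) p k u) (fderiv ℝ F p v) +
      h (fderiv ℝ F p u) (fderiv ℝ (fderiv ℝ F) p k v) = fderiv ℝ c p k * g u v := by
  have hDF (w : E) : HasFDerivAt (fun q => fderiv ℝ F q w)
      ((fderiv ℝ (fderiv ℝ F) p).flip w) p := by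
    simpa using ((differentiable_fderiv_of_contDiff_two hF) p).hasFDerivAt.clm_apply
      (hasFDerivAt_const w p)
  have hleft := h.hasFDerivAt_of_bilinear (hDF u) (hDF v)
  have hright := (hc p).hasFDerivAt.mul_const (g u v)
  simp only [hconf] at hleft
  have happly := DFunLike.congr_fun (hleft.unique hright) k
  simpa [add_comm, mul_comm] using happly

section DiagonalForm

open EuclideanSpace

variable {ι V W : Type*} [Fintype ι] [NormedAddCommGroup V] [NormedSpace ℝ V]
  [NormedAddCommGroup W] [NormedSpace ℝ W] {s : ι → ℝ}

/-- The pseudo-Euclidean metric `∑ i, s i * u i * v i` with diagonal coefficients `s`. -/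
noncomputable def diagonalForm (s : ι → ℝ) :
    EuclideanSpace ℝ ι →L[ℝ] EuclideanSpace ℝ ι →L[ℝ] ℝ :=
  ∑ i, s i • (proj i : EuclideanSpace ℝ ι →L[ℝ] ℝ).smulRight (proj i)

theorem diagonalForm_apply (s : ι → ℝ) (u v : EuclideanSpace ℝ ι) :
    diagonalForm s u v = ∑ i, s i * (u i * v i) := by
  simp [diagonalForm]

theorem diagonalForm_comm (s : ι → ℝ) (u v : EuclideanSpace ℝ ι) :
    diagonalForm s u v = diagonalForm s v u := by
  simp only [diagonalForm_apply, mul_comm (u _)]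

theorem eq_zero_of_forall_diagonalForm_eq_zero (hs : ∀ i, s i ≠ 0) {v : EuclideanSpace ℝ ι}
    (h : ∀ u, diagonalForm s v u = 0) : v = 0 := by
  classical
  ext i
  simpa [diagonalForm_apply, hs] using h (single i 1)

variable [DecidableEq ι]

theorem diagonalForm_single_right (s : ι → ℝ) (u : EuclideanSpace ℝ ι) (i : ι) :
    diagonalForm s u (single i 1) = s i * u i := by
  simp [diagonalForm_apply]

theorem sum_inv_mul_diagonalForm_smul_single (hs : ∀ i, s i ≠ 0) (v : EuclideanSpace ℝ ι) :
    ∑ i, ((s i)⁻¹ * diagonalForm s v (single i 1)) • single i (1 : ℝ) = v := by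
  ext j
  simp [diagonalForm_single_right, hs, Pi.single_apply]

theorem sum_inv_mul_diagonalForm_mul (hs : ∀ i, s i ≠ 0) (v : EuclideanSpace ℝ ι)
    (l : EuclideanSpace ℝ ι →L[ℝ] ℝ) :
    ∑ i, (s i)⁻¹ * (diagonalForm s v (single i 1) * l (single i 1)) = l v := by
  conv_rhs => rw [← sum_inv_mul_diagonalForm_smul_single hs v]
  simp [mul_assoc]

/-- The trace of a bilinear map with respect to the metric `diagonalForm s`; the weights are the
diagonal entries `(s i)⁻¹` of the inverse metric. -/
noncomputable def metricTrace (s : ι → ℝ)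
    (B : EuclideanSpace ℝ ι →L[ℝ] EuclideanSpace ℝ ι →L[ℝ] V) : V :=
  ∑ i, (s i)⁻¹ • B (single i 1) (single i 1)

theorem metricTrace_diagonalForm (hs : ∀ i, s i ≠ 0) :
    metricTrace s (diagonalForm s) = Fintype.card ι := by
  simp [metricTrace, diagonalForm_single_right, hs]

/-- The square of the conformal factor of `A` when `A` is conformal for `diagonalForm s`; in
general, the average of the pulled back metric. -/
noncomputable def squaredDilation (s : ι → ℝ) (A : EuclideanSpace ℝ ι →L[ℝ] EuclideanSpace ℝ ι) :
    ℝ :=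
  (Fintype.card ι : ℝ)⁻¹ * metricTrace s ((diagonalForm s).bilinearComp A A)

theorem metricTrace_bilinearComp_eq_of_traceless (hs : ∀ i, s i ≠ 0)
    {A : EuclideanSpace ℝ ι →L[ℝ] EuclideanSpace ℝ ι}
    (hA : ∀ B : EuclideanSpace ℝ ι →L[ℝ] EuclideanSpace ℝ ι →L[ℝ] ℝ,
      metricTrace s B = 0 → metricTrace s (B.bilinearComp A A) = 0)
    (B : EuclideanSpace ℝ ι →L[ℝ] EuclideanSpace ℝ ι →L[ℝ] ℝ) :
    metricTrace s (B.bilinearComp A A) = squaredDilation s A * metricTrace s B := by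
  cases isEmpty_or_nonempty ι
  · simp [metricTrace]
  set t : ℝ := (Fintype.card ι : ℝ)⁻¹ * metricTrace s B
  have hsub (C D : EuclideanSpace ℝ ι →L[ℝ] EuclideanSpace ℝ ι →L[ℝ] ℝ) :
      metricTrace s (C - t • D) = metricTrace s C - t * metricTrace s D := by
    simp [metricTrace, mul_sub, Finset.mul_sum, mul_left_comm]
  have htraceless : metricTrace s (B - t • diagonalForm s) = 0 := by
    rw [hsub, metricTrace_diagonalForm hs]
    simp only [t]
    field_simp
    ring
  have hpull : (B - t • diagonalForm s).bilinearComp A A =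
      B.bilinearComp A A - t • (diagonalForm s).bilinearComp A A := by
    ext
    simp
  have htrace := hA _ htraceless
  rw [hpull, hsub, sub_eq_zero] at htrace
  rw [htrace, squaredDilation]
  ring

theorem diagonalForm_map_map_of_metricTrace_bilinearComp (hs : ∀ i, s i ≠ 0)
    {A : EuclideanSpace ℝ ι →L[ℝ] EuclideanSpace ℝ ι} (hinj : Function.Injective A) {c : ℝ}
    (hA : ∀ B : EuclideanSpace ℝ ι →L[ℝ] EuclideanSpace ℝ ι →L[ℝ] ℝ,
      metricTrace s (B.bilinearComp A A) = c * metricTrace s B) (u v : EuclideanSpace ℝ ι) :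
    diagonalForm s (A u) (A v) = c * diagonalForm s u v := by
  -- `adj w` is the adjoint of `A` for the metric, applied to `w`.
  let adj (w : EuclideanSpace ℝ ι) : EuclideanSpace ℝ ι :=
    ∑ i, ((s i)⁻¹ * diagonalForm s w (A (single i 1))) • single i (1 : ℝ)
  have hadj (w x : EuclideanSpace ℝ ι) : diagonalForm s (adj w) x = diagonalForm s w (A x) := by
    calc diagonalForm s (adj w) x
        = ∑ i, (s i)⁻¹ * (diagonalForm s x (single i 1) * diagonalForm s w (A (single i 1))) := by
          simp [adj, diagonalForm_comm s x, mul_comm, mul_left_comm]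
      _ = diagonalForm s w (A x) :=
          sum_inv_mul_diagonalForm_mul hs x ((diagonalForm s w).comp A)
  have hA_adj (w : EuclideanSpace ℝ ι) : A (adj w) = c • w := by
    ext a
    let l : EuclideanSpace ℝ ι →L[ℝ] ℝ := proj a
    calc A (adj w) a = metricTrace s (((diagonalForm s w).smulRight l).bilinearComp A A) := by
          simp [adj, metricTrace, l, mul_assoc]
      _ = c * metricTrace s ((diagonalForm s w).smulRight l) := hA _
      _ = c * ∑ i, (s i)⁻¹ * (diagonalForm s w (single i 1) * l (single i 1)) := by
          simp [metricTrace]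
      _ = (c • w) a := by rw [sum_inv_mul_diagonalForm_mul hs]; rfl
  have hadj_A : adj (A u) = c • u := hinj (by rw [hA_adj, map_smul])
  rw [← hadj, hadj_A, map_smul, smul_apply, smul_eq_mul]

theorem sum_inv_mul_koszul (hs : ∀ i, s i ≠ 0) (l : EuclideanSpace ℝ ι →L[ℝ] ℝ)
    (w : EuclideanSpace ℝ ι) :
    ∑ i, (s i)⁻¹ * (l (single i 1) * diagonalForm s (single i 1) w +
      l (single i 1) * diagonalForm s (single i 1) w -
        l w * diagonalForm s (single i 1) (single i 1)) = (2 - Fintype.card ι) * l w := by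
  have hcontract : ∑ i, (s i)⁻¹ * (l (single i 1) * diagonalForm s (single i 1) w) = l w := by
    simpa only [diagonalForm_comm s w, mul_comm] using sum_inv_mul_diagonalForm_mul hs w l
  have hdim : ∑ i, (s i)⁻¹ * diagonalForm s (single i 1) (single i 1) = Fintype.card ι :=
    metricTrace_diagonalForm hs
  simp only [mul_sub, mul_add, Finset.sum_sub_distrib, Finset.sum_add_distrib, hcontract,
    mul_left_comm _ (l w), ← Finset.mul_sum, hdim]
  ring

/-- The second-order operator `∑ i, (s i)⁻¹ ∂²/∂x_i²` associated with the metric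
`diagonalForm s`: the Laplacian or the wave operator, according to the signs of `s`. -/
noncomputable def pseudoLaplacian (s : ι → ℝ) (f : EuclideanSpace ℝ ι → V)
    (p : EuclideanSpace ℝ ι) : V :=
  metricTrace s (fderiv ℝ (fderiv ℝ f) p)

theorem pseudoLaplacian_comp {ψ : EuclideanSpace ℝ ι → W}
    {F : EuclideanSpace ℝ ι → EuclideanSpace ℝ ι} (hψ : ContDiff ℝ 2 ψ) (hF : ContDiff ℝ 2 F)
    (p : EuclideanSpace ℝ ι) :
    pseudoLaplacian s (ψ ∘ F) p =
      metricTrace s ((fderiv ℝ (fderiv ℝ ψ) (F p)).bilinearComp (fderiv ℝ F p) (fderiv ℝ F p)) +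
        fderiv ℝ ψ (F p) (pseudoLaplacian s F p) := by
  simp [pseudoLaplacian, metricTrace, fderiv_fderiv_comp hψ hF, Finset.sum_add_distrib]

theorem fderiv_fderiv_eq_zero_of_conformal_of_harmonic (hs : ∀ i, s i ≠ 0)
    (hι : Fintype.card ι ≠ 2) {F : EuclideanSpace ℝ ι → EuclideanSpace ℝ ι}
    {c : EuclideanSpace ℝ ι → ℝ} (hF : ContDiff ℝ 2 F)
    (hinj : ∀ p, Function.Injective (fderiv ℝ F p)) (hc : Differentiable ℝ c)
    (hconf : ∀ p u v,
      diagonalForm s (fderiv ℝ F p u) (fderiv ℝ F p v) = c p * diagonalForm s u v)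
    (hharm : ∀ p, pseudoLaplacian s F p = 0) (p : EuclideanSpace ℝ ι) :
    fderiv ℝ (fderiv ℝ F) p = 0 := by
  have hsymm : IsSymmSndFDerivAt ℝ F p := hF.contDiffAt.isSymmSndFDerivAt (by simp)
  have hkoszul := koszul_formula
    (T := fun u v w => diagonalForm s (fderiv ℝ (fderiv ℝ F) p u v) (fderiv ℝ F p w))
    (g := fun u v w => fderiv ℝ c p u * diagonalForm s v w)
    (fun u v w => by rw [hsymm u v]) (fun u v w => by
      rw [← bilin_fderiv_fderiv_add_of_conformal hF hc hconf p u v w,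
        diagonalForm_comm s (fderiv ℝ F p v)])
  have hdc : fderiv ℝ c p = 0 := by
    ext w
    have htrace : ∑ i, (s i)⁻¹ * (2 * diagonalForm s
        (fderiv ℝ (fderiv ℝ F) p (single i 1) (single i 1)) (fderiv ℝ F p w)) = 0 := by
      have h := congrArg (fun x => 2 * diagonalForm s x (fderiv ℝ F p w)) (hharm p)
      simpa [pseudoLaplacian, metricTrace, Finset.mul_sum, mul_left_comm] using h
    simp only [hkoszul, sum_inv_mul_koszul hs] at htrace
    refine (mul_eq_zero.1 htrace).resolve_left (sub_ne_zero.2 fun h => hι ?_)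
    exact_mod_cast h.symm
  ext1 u
  ext1 v
  refine eq_zero_of_forall_diagonalForm_eq_zero hs fun x => ?_
  obtain ⟨w, rfl⟩ := (fderiv ℝ F p).toLinearMap.injective_iff_surjective.1 (hinj p) x
  simpa [hdc] using hkoszul u v w

/-- `F` is a harmonic morphism for the metric `diagonalForm s`: it pulls `C²` solutions of
`pseudoLaplacian s ψ = 0` back to solutions. -/
def IsHarmonicMorphism (s : ι → ℝ) (F : EuclideanSpace ℝ ι → EuclideanSpace ℝ ι) : Prop :=
  ∀ ψ : EuclideanSpace ℝ ι → ℝ, ContDiff ℝ 2 ψ → (∀ q, pseudoLaplacian s ψ q = 0) →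
    ∀ p, pseudoLaplacian s (ψ ∘ F) p = 0

namespace IsHarmonicMorphism

variable {F : EuclideanSpace ℝ ι → EuclideanSpace ℝ ι}

theorem pseudoLaplacian_eq_zero (h : IsHarmonicMorphism s F) (hF : ContDiff ℝ 2 F)
    (p : EuclideanSpace ℝ ι) : pseudoLaplacian s F p = 0 := by
  ext a
  let L : EuclideanSpace ℝ ι →L[ℝ] ℝ := proj a
  have hL (q : EuclideanSpace ℝ ι) : fderiv ℝ (fderiv ℝ L) q = 0 :=
    fderiv_fderiv_continuousLinearMap L q
  have hLF := h L L.contDiff (fun q => by simp [pseudoLaplacian, metricTrace, hL]) p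
  rw [pseudoLaplacian_comp L.contDiff hF, hL, L.fderiv] at hLF
  simpa [metricTrace, L] using hLF

theorem metricTrace_bilinearComp_fderiv_eq_zero (h : IsHarmonicMorphism s F)
    (hF : ContDiff ℝ 2 F) (p : EuclideanSpace ℝ ι)
    (B : EuclideanSpace ℝ ι →L[ℝ] EuclideanSpace ℝ ι →L[ℝ] ℝ) (hB : metricTrace s B = 0) :
    metricTrace s (B.bilinearComp (fderiv ℝ F p) (fderiv ℝ F p)) = 0 := by
  have hsq : ContDiff ℝ 2 fun q => B q q := by fun_prop
  have hdouble (A : EuclideanSpace ℝ ι →L[ℝ] EuclideanSpace ℝ ι) (q : EuclideanSpace ℝ ι) :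
      metricTrace s ((fderiv ℝ (fderiv ℝ fun q => B q q) q).bilinearComp A A) =
        2 * metricTrace s (B.bilinearComp A A) := by
    simp [metricTrace, fderiv_fderiv_bilin_diag, Finset.mul_sum, mul_left_comm, ← two_mul]
  have hsol (q : EuclideanSpace ℝ ι) : pseudoLaplacian s (fun q => B q q) q = 0 :=
    calc pseudoLaplacian s (fun q => B q q) q
        = 2 * metricTrace s (B.bilinearComp (.id ℝ _) (.id ℝ _)) := hdouble (.id ℝ _) q
      _ = 2 * metricTrace s B := rfl
      _ = 0 := by rw [hB, mul_zero]
  have hpull := h _ hsq hsol p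
  rw [pseudoLaplacian_comp hsq hF, hdouble, h.pseudoLaplacian_eq_zero hF, map_zero,
    add_zero] at hpull
  exact (mul_eq_zero.1 hpull).resolve_left two_ne_zero

theorem diagonalForm_fderiv_fderiv (h : IsHarmonicMorphism s F) (hs : ∀ i, s i ≠ 0)
    (hF : ContDiff ℝ 2 F) {p : EuclideanSpace ℝ ι} (hinj : Function.Injective (fderiv ℝ F p))
    (u v : EuclideanSpace ℝ ι) :
    diagonalForm s (fderiv ℝ F p u) (fderiv ℝ F p v) =
      squaredDilation s (fderiv ℝ F p) * diagonalForm s u v :=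
  diagonalForm_map_map_of_metricTrace_bilinearComp hs hinj
    (metricTrace_bilinearComp_eq_of_traceless hs
      (h.metricTrace_bilinearComp_fderiv_eq_zero hF p)) u v

theorem fderiv_fderiv_eq_zero (h : IsHarmonicMorphism s F) (hs : ∀ i, s i ≠ 0)
    (hι : Fintype.card ι ≠ 2) (hF : ContDiff ℝ 2 F)
    (hinj : ∀ p, Function.Injective (fderiv ℝ F p)) (p : EuclideanSpace ℝ ι) :
    fderiv ℝ (fderiv ℝ F) p = 0 := by
  have := differentiable_fderiv_of_contDiff_two hF
  refine fderiv_fderiv_eq_zero_of_conformal_of_harmonic hs hι hF hinj ?_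
    (fun p => h.diagonalForm_fderiv_fderiv hs hF (hinj p)) (h.pseudoLaplacian_eq_zero hF) p
  simp only [squaredDilation, metricTrace, ContinuousLinearMap.bilinearComp_apply]
  fun_prop

end IsHarmonicMorphism

end DiagonalForm

section CoordinateSystem

variable {n : ℕ} {Y : OpenPartialHomeomorph (Spacetime n) (Spacetime n)}

/-- The coefficients of the Minkowski metric, positive on space and negative on time. -/
def minkowskiSignature (n : ℕ) : Fin (n + 1) → ℝ := Fin.snoc (fun _ => 1) (-1)

theorem minkowskiSignature_ne_zero (i : Fin (n + 1)) : minkowskiSignature n i ≠ 0 := by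
  cases i using Fin.lastCases <;> simp [minkowskiSignature]

theorem pseudoLaplacian_minkowskiSignature (f : Spacetime n → ℝ) (p : Spacetime n) :
    pseudoLaplacian (minkowskiSignature n) f p =
      ∑ i : Fin n, fderiv ℝ (fderiv ℝ f) p (EuclideanSpace.single i.castSucc 1)
          (EuclideanSpace.single i.castSucc 1) -
        fderiv ℝ (fderiv ℝ f) p (EuclideanSpace.single (Fin.last n) 1)
          (EuclideanSpace.single (Fin.last n) 1) := by
  simp [pseudoLaplacian, metricTrace, Fin.sum_univ_castSucc, minkowskiSignature, sub_eq_add_neg]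

theorem coordPartial_comp (hY : Y.source = Set.univ) (i : Fin (n + 1)) (ψ : Spacetime n → ℝ) :
    coordPartial Y i (ψ ∘ Y) =
      (fun q => lineDeriv ℝ ψ q (EuclideanSpace.single i 1)) ∘ Y := by
  funext p
  apply Filter.EventuallyEq.lineDeriv_eq
  filter_upwards [Y.open_target.mem_nhds (Y.map_source (hY ▸ Set.mem_univ p))] with q hq
  simp [Y.right_inv hq]

theorem satisfiesWaveEquation_comp_iff (hY : Y.source = Set.univ) {ψ : Spacetime n → ℝ}
    (hψ : ContDiff ℝ 2 ψ) :
    SatisfiesWaveEquation Y (ψ ∘ Y) ↔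
      ∀ p, pseudoLaplacian (minkowskiSignature n) ψ (Y p) = 0 := by
  simp only [SatisfiesWaveEquation, coordPartial_comp hY, Function.comp_apply,
    lineDeriv_lineDeriv_eq_fderiv_fderiv hψ, pseudoLaplacian_minkowskiSignature]

theorem satisfiesWaveEquation_standardCoordinates_iff {φ : Spacetime n → ℝ}
    (hφ : ContDiff ℝ 2 φ) :
    SatisfiesWaveEquation (standardCoordinates n) φ ↔
      ∀ p, pseudoLaplacian (minkowskiSignature n) φ p = 0 :=
  satisfiesWaveEquation_comp_iff (Y := standardCoordinates n) rfl hφ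

namespace IsCoordinateSystem

variable {k : WithTop ℕ∞}

theorem contDiff (hY : IsCoordinateSystem k Y) : ContDiff ℝ k Y := by
  simpa only [hY.source_eq, contDiffOn_univ] using hY.contDiffOn

theorem fderiv_injective (hY : IsCoordinateSystem k Y) (hk : k ≠ 0) (p : Spacetime n) :
    Function.Injective (fderiv ℝ Y p) := by
  have hsource (q : Spacetime n) : q ∈ Y.source := hY.source_eq ▸ Set.mem_univ q
  refine fderiv_injective_of_leftInverse (hY.contDiff.differentiable hk p) ?_
    fun q => Y.left_inv (hsource q)
  exact (hY.contDiffOn_symm.contDiffAt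
    (Y.open_target.mem_nhds (Y.map_source (hsource p)))).differentiableAt hk

theorem of_affineEquiv (hY : Y.source = Set.univ) {A : Spacetime n ≃ᵃ[ℝ] Spacetime n}
    (hA : ∀ p, Y p = A p) : IsCoordinateSystem k Y where
  source_eq := hY
  contDiffOn :=
    ((AffineEquiv.toContinuousAffineEquiv A).toContinuousAffineMap.contDiff.contDiffOn).congr
      fun p _ => hA p
  contDiffOn_symm := by
    refine ((AffineEquiv.toContinuousAffineEquiv
      A.symm).toContinuousAffineMap.contDiff.contDiffOn).congr fun q hq => ?_
    change Y.symm q = A.symm q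
    rw [A.eq_symm_apply, ← hA, Y.right_inv hq]

theorem isHarmonicMorphism (hY : IsCoordinateSystem 2 Y)
    (hwave : ∀ φ : Spacetime n → ℝ, ContDiff ℝ 2 φ →
      SatisfiesWaveEquation Y φ → SatisfiesWaveEquation (standardCoordinates n) φ) :
    IsHarmonicMorphism (minkowskiSignature n) Y := fun _ hψ hsol =>
  have hψY := hψ.comp hY.contDiff
  (satisfiesWaveEquation_standardCoordinates_iff hψY).1 <|
    hwave _ hψY ((satisfiesWaveEquation_comp_iff hY.source_eq hψ).2 fun p => hsol (Y p))

end IsCoordinateSystem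

end CoordinateSystem

theorem corollary2p4_general (n : ℕ) (hn : n ≠ 1)
    (Y : OpenPartialHomeomorph (Spacetime n) (Spacetime n))
    (hY : IsCoordinateSystem 2 Y)
    (hwave : ∀ φ : Spacetime n → ℝ, ContDiff ℝ 2 φ →
      SatisfiesWaveEquation Y φ → SatisfiesWaveEquation (standardCoordinates n) φ) :
    IsCoordinateSystem ∞ Y ∧
      ∃ A : Spacetime n ≃ᵃ[ℝ] Spacetime n, ∀ p : Spacetime n, Y p = A p := by
  have hinj := hY.fderiv_injective two_ne_zero
  have hD2 : ∀ p, fderiv ℝ (fderiv ℝ Y) p = 0 :=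
    (hY.isHarmonicMorphism hwave).fderiv_fderiv_eq_zero minkowskiSignature_ne_zero
      (by simpa using hn) hY.contDiff hinj
  obtain ⟨A, hA⟩ := exists_affineEquiv_of_fderiv_fderiv_eq_zero hY.contDiff (hinj 0) hD2
  exact ⟨.of_affineEquiv hY.source_eq hA, A, hA⟩

theorem corollary2p4 (n : ℕ) (hn : 2 ≤ n)
    (Y : OpenPartialHomeomorph (Spacetime n) (Spacetime n))
    (hY : IsCoordinateSystem 2 Y)
    (hwave : ∀ φ : Spacetime n → ℝ, ContDiff ℝ 2 φ →
      (SatisfiesWaveEquation (standardCoordinates n) φ ↔ SatisfiesWaveEquation Y φ)) :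
    IsCoordinateSystem ∞ Y ∧
      ∃ A : Spacetime n ≃ᵃ[ℝ] Spacetime n, ∀ p : Spacetime n, Y p = A p :=
  corollary2p4_general n (by omega) Y hY fun φ hφ => (hwave φ hφ).2
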